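/- Let $\mathbb{D}=\{z\in\mathbb{C}:|z|<1\}$. Let $f$ and $g(z)=\sum_{k=0}^{\infty}b_kz^k$ be analytic in $\mathbb{D}$, where $f$ is convex univalent (that is, $f$ is injective on $\mathbb{D}$ and $f(\mathbb{D})$ is a convex set) and $g$ is subordinate to $f$ (that is, $g=f\circ\omega$ on $\mathbb{D}$ for some analytic $\omega:\mathbb{D}\to\mathbb{D}$ with $\omega(0)=0$). Then $$|g(z)|+\sum_{k=1}^{\infty}|b_k|r^k\le |f(0)|+\operatorname{dist}\bigl(f(0),\partial f(\mathbb{D})\bigr)\qquad\text{for all } |z|=r\le \tfrac15 .$$ The radius $1/5$ is sharp, as shown by $f(z)=z/(1-z)$: this function is convex univalent in $\mathbb{D}$, and for every $r\in(1/5,1)$ the inequality fails for $g=f$ at the point $z=r$. -/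

import Mathlib

/-- The open unit disk in the complex plane. -/
def unitDisk : Set ℂ := Metric.ball (0 : ℂ) 1

/-- `f` is a convex (univalent) function: analytic and injective on the unit disk, with convex
image of the unit disk. -/
structure IsConvexUnivalent (f : ℂ → ℂ) : Prop where
  analytic : DifferentiableOn ℂ f unitDisk
  univalent : Set.InjOn f unitDisk
  convex_image : Convex ℝ (f '' unitDisk)

/-- `g ≺ f` on the unit disk: `g = f ∘ ω` there, for an analytic self-map `ω` of the disk
which fixes the origin. -/
def IsSubordinate (g f : ℂ → ℂ) : Prop :=
  ∃ ω : ℂ → ℂ, DifferentiableOn ℂ ω unitDisk ∧ Set.MapsTo ω unitDisk unitDisk ∧ ω 0 = 0 ∧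
    ∀ z ∈ unitDisk, g z = f (ω z)

/-- The family `S(f)` of functions subordinate to `f`. -/
def subordinationClass (f : ℂ → ℂ) : Set (ℂ → ℂ) := {g | IsSubordinate g f}

/-- The `k`-th Taylor coefficient of `g` at the origin. -/
noncomputable def taylorCoeff (g : ℂ → ℂ) (k : ℕ) : ℂ :=
  iteratedDeriv k g 0 / (k.factorial : ℂ)

/-- The distance from `f 0` to the boundary of the image of the unit disk under `f`. -/
noncomputable def boundaryDist (f : ℂ → ℂ) : ℝ :=
  Metric.infDist (f 0) (frontier (f '' unitDisk))

/-!
Let `d` be the distance from `f 0` to the boundary of the convex domain `Ω = f '' unitDisk`. Since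
the disk is not biholomorphic to `ℂ` (`image_unitDisk_ne_univ`), the boundary is nonempty, so `d` is
attained at some boundary point `p`. As `Ω` is open and convex, it lies in an open half-plane
`Re (c * w) < Re (c * p)` with `c ≠ 0`. For `g` subordinate to `f`, the function
`z ↦ c * (p - g z)` then has positive real part on the disk, and its value `c * (p - f 0)` at the
origin has real part at most `‖c‖ * d`. Carathéodory's coefficient inequality
`|c_k| ≤ 2 Re c_0` (`norm_taylorCoeff_le_two_mul_re`) therefore gives `|b_k| ≤ 2 d` for all `k ≥ 1`
(`norm_taylorCoeff_le_two_mul_boundaryDist`).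

Hence `∑_{k ≥ 1} |b_k| r ^ k ≤ 2 d r / (1 - r) ≤ d / 2` for `r ≤ 1 / 5`, and the same sum bounds
`|g z - f 0|`; adding the two estimates gives the inequality. For `f z = z / (1 - z)` the image is
the half-plane `Re w > -1 / 2`, so `d ≤ 1 / 2`, all `b_k` with `k ≥ 1` are `1`, and at `z = r` both
terms on the left equal `r / (1 - r)`, which exceeds `1 / 4` when `r > 1 / 5`.
-/

open Metric Set Filter Topology Complex Real

/-! ### Coefficients of functions with nonnegative real part -/

/-- **Carathéodory's coefficient inequality**. On a circle of radius `r`, the mean of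
`2 * re (h z) * conj z ^ k` is `r ^ (2 * k)` times the `k`-th coefficient, while its modulus is
bounded by the mean of `2 * r ^ k * re (h z)`; then let `r → 1`. -/
theorem norm_taylorCoeff_le_two_mul_re {h : ℂ → ℂ} (hd : DifferentiableOn ℂ h unitDisk)
    (hre : ∀ z ∈ unitDisk, 0 ≤ (h z).re) {k : ℕ} (hk : k ≠ 0) :
    ‖taylorCoeff h k‖ ≤ 2 * (h 0).re := by
  have key : ∀ r : ℝ, 0 < r → r < 1 → ‖taylorCoeff h k‖ * r ^ k ≤ 2 * (h 0).re := by
    intro r hr0 hr1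
    have hsub : closedBall (0 : ℂ) |r| ⊆ unitDisk := by
      rw [abs_of_pos hr0]; exact closedBall_subset_ball hr1
    have hsph : sphere (0 : ℂ) |r| ⊆ unitDisk := sphere_subset_closedBall.trans hsub
    have hd' : DifferentiableOn ℂ h (closedBall 0 |r|) := hd.mono hsub
    have hne : ∀ z ∈ sphere (0 : ℂ) |r|, z ≠ 0 := by
      intro z hz h0
      simp [h0, eq_comm, hr0.ne'] at hz
    have hc : ContinuousOn h (sphere 0 |r|) := hd.continuousOn.mono hsph
    have A0 : circleAverage h 0 r = h 0 :=
      DiffContOnCl.circleAverage (hd'.mono closure_ball_subset_closedBall).diffContOnCl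
    have A1 : circleAverage (fun z => h z * z ^ k) 0 r = 0 := by
      rw [DiffContOnCl.circleAverage (DifferentiableOn.diffContOnCl
        (DifferentiableOn.mono (by fun_prop) closure_ball_subset_closedBall))]
      simp [hk]
    have A2 : circleAverage (fun z => (r : ℂ) ^ (2 * k) * (h z / z ^ k)) 0 r
        = r ^ (2 * k) * taylorCoeff h k := by
      have := DifferentiableOn.circleIntegral_one_div_sub_center_pow_smul (c := 0) hr0 k
        (by rwa [abs_of_pos hr0] at hd')
      rw [circleAverage_eq_circleIntegral hr0.ne']
      have e : (∮ z in C(0, r), (z - 0)⁻¹ • ((r : ℂ) ^ (2 * k) * (h z / z ^ k))) =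
          (r : ℂ) ^ (2 * k) • ∮ z in C(0, r), (1 / (z - 0) ^ (k + 1)) • h z := by
        rw [← circleIntegral.integral_smul]
        congr 1; ext z
        simp only [sub_zero, smul_eq_mul, pow_succ, div_eq_mul_inv, mul_inv, one_mul]; ring
      rw [e, this, taylorCoeff]
      have : (2 * π * I : ℂ) ≠ 0 := two_pi_I_ne_zero
      simp only [smul_eq_mul]
      field_simp
    -- Write `2 * re h = h + conj h`. On the circle `conj z ^ k = r ^ (2 * k) / z ^ k`, so the part
    -- with `h` gives the coefficient; the part with `conj h` is conjugate to `h z * z ^ k`,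
    -- whose mean is zero.
    have A3 : circleAverage (fun z => (2 * (h z).re : ℝ) * (starRingEnd ℂ z) ^ k) 0 r
        = r ^ (2 * k) * taylorCoeff h k := by
      have c1 : circleAverage (fun z => starRingEnd ℂ (h z * z ^ k)) 0 r = 0 := by
        have := ContinuousLinearMap.circleAverage_comp_comm (conjCLE : ℂ →L[ℝ] ℂ)
          (f := fun z => h z * z ^ k) (c := 0) (R := r)
          (ContinuousOn.circleIntegrable' (by fun_prop))
        rw [A1, map_zero] at this
        simpa [Function.comp_def] using this
      have c2 := circleAverage_fun_add (c := 0) (R := r)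
        (f₁ := fun z => starRingEnd ℂ (h z * z ^ k))
        (f₂ := fun z => (r : ℂ) ^ (2 * k) * (h z / z ^ k))
        (ContinuousOn.circleIntegrable' (continuous_conj.comp_continuousOn (by fun_prop)))
        (ContinuousOn.circleIntegrable'
          (continuousOn_const.mul (hc.div (by fun_prop) fun z hz => pow_ne_zero _ (hne z hz))))
      rw [c1, A2, zero_add] at c2
      rw [← c2]
      refine circleAverage_congr_sphere fun z hz => ?_
      have hz0 := hne z hz
      have hzr : z * starRingEnd ℂ z = (r : ℂ) ^ 2 := by
        have : ‖z‖ = r := by simpa [abs_of_pos hr0] using hz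
        rw [mul_conj, normSq_eq_norm_sq, this]
        push_cast
        rfl
      have hcz : (r : ℂ) ^ (2 * k) / z ^ k = (starRingEnd ℂ z) ^ k := by
        rw [pow_mul, ← hzr, mul_pow]
        field_simp
      have h2 : ((2 * (h z).re : ℝ) : ℂ) = h z + starRingEnd ℂ (h z) := (add_conj _).symm
      simp only [h2, ← hcz, map_mul, map_pow]
      ring
    have A4 : circleAverage (fun z => (h z).re) 0 r = (h 0).re := by
      have := ContinuousLinearMap.circleAverage_comp_comm reCLM
          (f := h) (c := 0) (R := r) (ContinuousOn.circleIntegrable' hc)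
      rw [A0] at this
      simpa [Function.comp_def] using this
    have A5 : ‖circleAverage (fun z => (2 * (h z).re : ℝ) * (starRingEnd ℂ z) ^ k) 0 r‖ ≤
        circleAverage (fun z => (2 * r ^ k) * (h z).re) 0 r := by
      rw [circleAverage_def, circleAverage_def, norm_smul, smul_eq_mul,
        norm_of_nonneg (by positivity)]
      gcongr
      refine intervalIntegral.norm_integral_le_of_norm_le (by positivity) ?_ ?_
      · refine Eventually.of_forall fun θ _ => ?_
        have hm : circleMap 0 r θ ∈ unitDisk := hsph (circleMap_mem_sphere' 0 r θ)
        have := hre _ hm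
        rw [norm_mul, norm_pow, RCLike.norm_conj, norm_circleMap_zero, abs_of_pos hr0, norm_real,
          norm_of_nonneg (by positivity)]
        exact le_of_eq (by ring)
      · have : ContinuousOn (fun z => (2 * r ^ k) * (h z).re) (sphere 0 |r|) :=
          continuousOn_const.mul (continuous_re.comp_continuousOn hc)
        exact this.circleIntegrable'
    have A6 : circleAverage (fun z => (2 * r ^ k) * (h z).re) 0 r = (2 * r ^ k) * (h 0).re := by
      rw [← A4]
      exact circleAverage_fun_smul (a := 2 * r ^ k) (f := fun z => (h z).re)
    rw [A3, A6, norm_mul, norm_pow, norm_real, norm_of_nonneg hr0.le, two_mul k, pow_add] at A5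
    have : 0 < r ^ k := by positivity
    nlinarith
  have ht : Tendsto (fun r : ℝ => ‖taylorCoeff h k‖ * r ^ k) (𝓝[<] 1) (𝓝 (‖taylorCoeff h k‖)) := by
    have : Continuous fun r : ℝ => ‖taylorCoeff h k‖ * r ^ k := by fun_prop
    simpa using (this.tendsto 1).mono_left nhdsWithin_le_nhds
  refine le_of_tendsto ht ?_
  filter_upwards [Ioo_mem_nhdsLT zero_lt_one] with r hr using key r hr.1 hr.2

/-! ### The image of a univalent function -/

theorem isOpen_image_of_injOn {f : ℂ → ℂ} (hd : DifferentiableOn ℂ f unitDisk)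
    (hi : InjOn f unitDisk) {V : Set ℂ} (hV : V ⊆ unitDisk) (hVo : IsOpen V) : IsOpen (f '' V) := by
  have han : AnalyticOnNhd ℂ f unitDisk := hd.analyticOnNhd isOpen_ball
  rcases han.is_constant_or_isOpen (convex_ball _ _).isPreconnected with ⟨w, hw⟩ | h
  · have h0 : (0 : ℂ) ∈ unitDisk := by simp [unitDisk]
    have h1 : (1 / 2 : ℂ) ∈ unitDisk := by norm_num [unitDisk]
    have := hi h0 h1 ((hw _ h0).trans (hw _ h1).symm)
    norm_num at this
  · exact h V hV hVo

/-- The unit disk cannot be mapped biholomorphically onto `ℂ`. If `f` did so, then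
`(z - a) / (f z - f a)` would be holomorphic and zero-free on the disk, and it would tend to `0` at
the unit circle because `f` would be proper; by the maximum principle it would vanish. -/
theorem image_unitDisk_ne_univ {f : ℂ → ℂ} (hd : DifferentiableOn ℂ f unitDisk)
    (hi : InjOn f unitDisk) : f '' unitDisk ≠ univ := by
  intro hU
  have hDo : IsOpen unitDisk := isOpen_ball
  -- A point with `deriv f a ≠ 0` keeps `dslope f a` free of zeros, also at `a`.
  obtain ⟨a, ha, hfa⟩ : ∃ a ∈ unitDisk, deriv f a ≠ 0 := by
    by_contra! hcon
    have h0 : (0 : ℂ) ∈ unitDisk := by simp [unitDisk]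
    have h1 : (1 / 2 : ℂ) ∈ unitDisk := by norm_num [unitDisk]
    have := hi h0 h1 (hDo.is_const_of_deriv_eq_zero (convex_ball _ _).isPreconnected hd hcon h0 h1)
    norm_num at this
  set q : ℂ → ℂ := fun z => (dslope f a z)⁻¹ with hq
  have hsl : ∀ z ∈ unitDisk, dslope f a z ≠ 0 := by
    intro z hz
    rcases eq_or_ne z a with rfl | hza
    · rwa [dslope_same]
    · rw [dslope_of_ne _ hza, slope_def_field]
      exact div_ne_zero (sub_ne_zero.2 fun h => hza (hi hz ha h)) (sub_ne_zero.2 hza)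
  have hqd : DifferentiableOn ℂ q unitDisk :=
    ((differentiableOn_dslope (hDo.mem_nhds ha)).2 hd).inv hsl
  have hsurj : SurjOn f unitDisk univ := by rw [SurjOn, hU]
  set ψ := Function.invFunOn f unitDisk
  have hψD : ∀ w, ψ w ∈ unitDisk := fun w => Function.invFunOn_mem (hsurj (mem_univ w))
  have hfψ : ∀ w, f (ψ w) = w := fun w => Function.invFunOn_eq (hsurj (mem_univ w))
  have hψf : ∀ z ∈ unitDisk, ψ (f z) = z := fun z hz => hi (hψD _) hz (hfψ _)
  have hψ : Continuous ψ := by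
    refine continuous_def.2 fun V hV => ?_
    have : ψ ⁻¹' V = f '' (V ∩ unitDisk) := by
      ext w
      constructor
      · exact fun hw => ⟨ψ w, ⟨hw, hψD w⟩, hfψ w⟩
      · rintro ⟨z, ⟨hz, hzD⟩, rfl⟩
        simpa [hψf z hzD] using hz
    rw [this]
    exact isOpen_image_of_injOn hd hi inter_subset_right (hV.inter hDo)
  -- The maximum principle on `{z | ‖f z - f a‖ < R}`, whose closure is compact in the disk.
  have bound : ∀ R : ℝ, 0 < R → ‖q a‖ ≤ 2 / R := by
    intro R hR
    have hKc : IsCompact (ψ '' closedBall (f a) R) := (isCompact_closedBall _ _).image hψ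
    set U : Set ℂ := unitDisk ∩ f ⁻¹' ball (f a) R
    have hUo : IsOpen U := hd.continuousOn.isOpen_inter_preimage hDo isOpen_ball
    have hUK : closure U ⊆ ψ '' closedBall (f a) R :=
      closure_minimal (fun z hz => ⟨f z, ball_subset_closedBall hz.2, hψf z hz.1⟩) hKc.isClosed
    have hKD : ψ '' closedBall (f a) R ⊆ unitDisk := by rintro _ ⟨w, -, rfl⟩; exact hψD w
    refine norm_le_of_forall_mem_frontier_norm_le (hKc.isBounded.subset (subset_closure.trans hUK))
      (hqd.mono (hUK.trans hKD)).diffContOnCl ?_ (subset_closure (⟨ha, by simpa using hR⟩ : a ∈ U))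
    intro z hz
    rw [hUo.frontier_eq] at hz
    have hzD := hKD (hUK hz.1)
    have hzR : R ≤ ‖f z - f a‖ := by
      by_contra! hlt
      exact hz.2 ⟨hzD, by simpa [dist_eq_norm] using hlt⟩
    have hza : z ≠ a := by rintro rfl; simp at hzR; linarith
    simp only [hq]
    rw [dslope_of_ne _ hza, slope_def_field, inv_div, norm_div]
    have h1 : ‖z‖ < 1 := by simpa [unitDisk] using hzD
    have h2 : ‖a‖ < 1 := by simpa [unitDisk] using ha
    gcongr
    linarith [norm_sub_le z a]
  have hqa : 0 < ‖q a‖ := norm_pos_iff.2 (inv_ne_zero (hsl a ha))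
  have := bound (4 / ‖q a‖) (by positivity)
  rw [div_div_eq_mul_div] at this
  linarith

theorem frontier_image_nonempty {f : ℂ → ℂ} (hd : DifferentiableOn ℂ f unitDisk)
    (hi : InjOn f unitDisk) : (frontier (f '' unitDisk)).Nonempty := by
  have h0 : (0 : ℂ) ∈ unitDisk := by simp [unitDisk]
  rw [nonempty_iff_ne_empty, Ne, ← isClopen_iff_frontier_eq_empty, isClopen_iff, not_or]
  exact ⟨(Set.Nonempty.image f ⟨0, h0⟩).ne_empty, image_unitDisk_ne_univ hd hi⟩

/-! ### The inequality for subordinate functions -/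

theorem taylorCoeff_const_sub_mul (g : ℂ → ℂ) (a c : ℂ) {k : ℕ} (hk : k ≠ 0) :
    taylorCoeff (fun z => a - c * g z) k = -(c * taylorCoeff g k) := by
  rw [taylorCoeff, taylorCoeff, iteratedDeriv_const_sub (Nat.pos_of_ne_zero hk),
    iteratedDeriv_neg, iteratedDeriv_const_mul_field]
  ring

/-- Compare `g` with the supporting half-plane of `f '' unitDisk` at a boundary point nearest to
`f 0`, and apply Carathéodory's inequality. -/
theorem norm_taylorCoeff_le_two_mul_boundaryDist {f g : ℂ → ℂ} (hg : DifferentiableOn ℂ g unitDisk)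
    (hf : IsConvexUnivalent f) (hgf : g ∈ subordinationClass f) {k : ℕ} (hk : k ≠ 0) :
    ‖taylorCoeff g k‖ ≤ 2 * boundaryDist f := by
  obtain ⟨ω, -, hωm, hω0, hgω⟩ := hgf
  have h0 : (0 : ℂ) ∈ unitDisk := by simp [unitDisk]
  have hΩ : IsOpen (f '' unitDisk) :=
    isOpen_image_of_injOn hf.analytic hf.univalent subset_rfl isOpen_ball
  obtain ⟨p, hp, hpd⟩ := isClosed_frontier.exists_infDist_eq_dist
    (frontier_image_nonempty hf.analytic hf.univalent) (f 0)
  have hpΩ : p ∉ f '' unitDisk := by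
    rw [hΩ.frontier_eq] at hp; exact hp.2
  obtain ⟨L, hL⟩ := RCLike.geometric_hahn_banach_open_point (𝕜 := ℂ) hf.convex_image hΩ hpΩ
  have hLc : ∀ w, L w = L 1 * w := fun w => by
    rw [mul_comm, ← smul_eq_mul, ← map_smul, smul_eq_mul, mul_one]
  set c := L 1
  replace hL : ∀ w ∈ f '' unitDisk, (c * w).re < (c * p).re := fun w hw => by
    rw [← hLc, ← hLc]
    exact hL w hw
  have hc : c ≠ 0 := by
    intro h
    have := hL (f 0) (mem_image_of_mem f h0)
    simp [h] at this
  have hcar := norm_taylorCoeff_le_two_mul_re (h := fun z => c * p - c * g z)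
    ((differentiableOn_const _).sub (hg.const_mul c)) (fun z hz => by
      have := hL (g z) (by rw [hgω z hz]; exact mem_image_of_mem f (hωm hz))
      rw [sub_re]
      exact sub_nonneg.2 this.le) hk
  rw [taylorCoeff_const_sub_mul g _ _ hk, norm_neg, norm_mul, ← mul_sub, hgω 0 h0, hω0] at hcar
  have hre := (re_le_norm (c * (p - f 0)))
  rw [norm_mul, ← dist_eq_norm, dist_comm, ← hpd] at hre
  change _ ≤ ‖c‖ * boundaryDist f at hre
  have : 0 < ‖c‖ := norm_pos_iff.2 hc
  nlinarith

theorem hasSum_taylorCoeff {g : ℂ → ℂ} (hg : DifferentiableOn ℂ g unitDisk) {z : ℂ}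
    (hz : z ∈ unitDisk) : HasSum (fun k => taylorCoeff g k * z ^ k) (g z) := by
  have e : (fun k => taylorCoeff g k * z ^ k) =
      fun k : ℕ => (k.factorial : ℂ)⁻¹ • (z - 0) ^ k • iteratedDeriv k g 0 := by
    funext k
    simp only [taylorCoeff, sub_zero, smul_eq_mul]
    ring
  rw [e]
  exact hasSum_taylorSeries_on_ball hg hz

theorem bohr_inequality {f g : ℂ → ℂ} (hg : DifferentiableOn ℂ g unitDisk)
    (hf : IsConvexUnivalent f) (hgf : g ∈ subordinationClass f) {z : ℂ} (hz : ‖z‖ ≤ 1 / 5) :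
    Summable (fun k : ℕ => ‖taylorCoeff g (k + 1)‖ * ‖z‖ ^ (k + 1)) ∧
      ‖g z‖ + ∑' k : ℕ, ‖taylorCoeff g (k + 1)‖ * ‖z‖ ^ (k + 1) ≤ ‖f 0‖ + boundaryDist f := by
  have h0 : (0 : ℂ) ∈ unitDisk := by simp [unitDisk]
  have hzD : z ∈ unitDisk := by simp only [unitDisk, mem_ball_zero_iff]; linarith
  have hd0 : 0 ≤ boundaryDist f := infDist_nonneg
  have hg0 : g 0 = f 0 := by
    obtain ⟨ω, -, -, hω0, hgω⟩ := hgf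
    rw [hgω 0 h0, hω0]
  have hgeo := ((hasSum_geometric_of_lt_one (norm_nonneg z) (by linarith)).mul_left
    (2 * boundaryDist f * ‖z‖))
  have hle : ∀ k : ℕ, ‖taylorCoeff g (k + 1)‖ * ‖z‖ ^ (k + 1) ≤
      2 * boundaryDist f * ‖z‖ * ‖z‖ ^ k := fun k => by
    rw [mul_assoc (2 * boundaryDist f), ← pow_succ']
    gcongr
    exact norm_taylorCoeff_le_two_mul_boundaryDist hg hf hgf k.succ_ne_zero
  have hs := Summable.of_nonneg_of_le (fun k => by positivity) hle hgeo.summable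
  have hS : ∑' k : ℕ, ‖taylorCoeff g (k + 1)‖ * ‖z‖ ^ (k + 1) ≤ boundaryDist f / 2 := by
    refine (hs.tsum_le_tsum hle hgeo.summable).trans ?_
    rw [hgeo.tsum_eq, ← div_eq_mul_inv, div_le_iff₀ (by linarith)]
    nlinarith
  have hgz : ‖g z - f 0‖ ≤ ∑' k : ℕ, ‖taylorCoeff g (k + 1)‖ * ‖z‖ ^ (k + 1) := by
    have h1 := (hasSum_nat_add_iff' 1).2 (hasSum_taylorCoeff hg hzD)
    simp only [Finset.range_one, Finset.sum_singleton, pow_zero, mul_one] at h1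
    have e : taylorCoeff g 0 = f 0 := by simp [taylorCoeff, hg0]
    rw [e] at h1
    rw [← h1.tsum_eq]
    refine (norm_tsum_le_tsum_norm ?_).trans_eq ?_ <;> simp only [norm_mul, norm_pow]
    exact hs
  refine ⟨hs, ?_⟩
  linarith [norm_sub_norm_le (g z) (f 0)]

/-! ### The extremal function `z / (1 - z)` -/

theorem div_one_sub_eq {z : ℂ} (hz : z ≠ 1) : z / (1 - z) = -1 + (1 - z)⁻¹ := by
  have : 1 - z ≠ 0 := sub_ne_zero.2 hz.symm
  field_simp
  ring

theorem ne_one_of_mem_unitDisk {z : ℂ} (hz : z ∈ unitDisk) : z ≠ 1 := by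
  rintro rfl
  simp [unitDisk] at hz

theorem image_div_one_sub : (fun z : ℂ => z / (1 - z)) '' unitDisk = {w | -(1 / 2) < w.re} := by
  -- The inverse map is `w ↦ w / (1 + w)`, so `‖z‖ < 1` reads `‖w‖ < ‖1 + w‖`.
  have key : ∀ w : ℂ, -(1 / 2) < w.re ↔ ‖w‖ < ‖1 + w‖ := by
    intro w
    rw [← sq_lt_sq₀ (norm_nonneg _) (norm_nonneg _), ← normSq_eq_norm_sq, ← normSq_eq_norm_sq,
      normSq_apply, normSq_apply]
    simp only [add_re, one_re, add_im, one_im]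
    constructor <;> intro h <;> nlinarith
  ext w
  simp only [mem_ofPred_eq, mem_image, key]
  constructor
  · rintro ⟨z, hz, rfl⟩
    have h1 : 1 - z ≠ 0 := sub_ne_zero.2 (ne_one_of_mem_unitDisk hz).symm
    have h2 : 1 + z / (1 - z) = 1 / (1 - z) := by field_simp; ring
    rw [h2, norm_div, norm_div, norm_one]
    have : 0 < ‖1 - z‖ := norm_pos_iff.2 h1
    gcongr
    simpa [unitDisk] using hz
  · intro hw
    have h1 : 1 + w ≠ 0 := by
      intro h; rw [h, norm_zero] at hw; exact (norm_nonneg w).not_gt hw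
    refine ⟨w / (1 + w), ?_, ?_⟩
    · rw [unitDisk, mem_ball_zero_iff, norm_div, div_lt_one (norm_pos_iff.2 h1)]
      exact hw
    · have : 1 - w / (1 + w) = 1 / (1 + w) := by field_simp; ring
      rw [this]; field_simp

theorem isConvexUnivalent_div_one_sub : IsConvexUnivalent (fun z : ℂ => z / (1 - z)) where
  analytic := by
    refine DifferentiableOn.div (by fun_prop) (by fun_prop) fun z hz => ?_
    exact sub_ne_zero.2 (ne_one_of_mem_unitDisk hz).symm
  univalent := by
    intro z hz w hw h
    simp only [div_one_sub_eq (ne_one_of_mem_unitDisk hz),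
      div_one_sub_eq (ne_one_of_mem_unitDisk hw)] at h
    simpa using h
  convex_image := by
    rw [image_div_one_sub]
    exact convex_halfSpace_re_gt _

theorem boundaryDist_div_one_sub_le : boundaryDist (fun z : ℂ => z / (1 - z)) ≤ 1 / 2 := by
  have hm : (-(1 / 2) : ℂ) ∈ frontier ((fun z : ℂ => z / (1 - z)) '' unitDisk) := by
    rw [image_div_one_sub, frontier_setOfPred_lt_re]
    simp
  refine (infDist_le_dist_of_mem hm).trans ?_
  norm_num

theorem taylorCoeff_div_one_sub {k : ℕ} (hk : k ≠ 0) :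
    taylorCoeff (fun z : ℂ => z / (1 - z)) k = 1 := by
  have e : (fun z : ℂ => z / (1 - z)) =ᶠ[𝓝 0] fun z => -1 + (-1 * z + 1)⁻¹ := by
    filter_upwards [isOpen_ne.mem_nhds (zero_ne_one : (0 : ℂ) ≠ 1)] with z hz
    rw [div_one_sub_eq hz, show -1 * z + 1 = 1 - z by ring]
  rw [taylorCoeff, e.iteratedDeriv_eq, iteratedDeriv_const_add (Nat.pos_of_ne_zero hk),
    iteratedDeriv_eq_iterate, iter_deriv_inv_linear]
  have : (k.factorial : ℂ) ≠ 0 := mod_cast k.factorial_ne_zero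
  simp only [mul_zero, zero_add, one_zpow, mul_one]
  rw [mul_right_comm, ← mul_pow]
  field_simp
  simp

theorem theorem8 :
    (∀ f g : ℂ → ℂ, DifferentiableOn ℂ g unitDisk → IsConvexUnivalent f →
      g ∈ subordinationClass f →
        (frontier (f '' unitDisk)).Nonempty ∧
        ∀ z : ℂ, ‖z‖ ≤ 1 / 5 →
          Summable (fun k : ℕ => ‖taylorCoeff g (k + 1)‖ * ‖z‖ ^ (k + 1)) ∧
          ‖g z‖ + ∑' k : ℕ, ‖taylorCoeff g (k + 1)‖ * ‖z‖ ^ (k + 1) ≤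
            ‖f 0‖ + boundaryDist f) ∧
    (∀ f₀ : ℂ → ℂ, f₀ = (fun z : ℂ => z / (1 - z)) →
      IsConvexUnivalent f₀ ∧ f₀ ∈ subordinationClass f₀ ∧
        ∀ r : ℝ, 1 / 5 < r → r < 1 →
          Summable (fun k : ℕ => ‖taylorCoeff f₀ (k + 1)‖ * r ^ (k + 1)) ∧
          ‖f₀ 0‖ + boundaryDist f₀ <
            ‖f₀ (r : ℂ)‖ + ∑' k : ℕ, ‖taylorCoeff f₀ (k + 1)‖ * r ^ (k + 1)) := by
  refine ⟨fun f g hg hf hgf => ⟨frontier_image_nonempty hf.analytic hf.univalent,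
    fun z hz => bohr_inequality hg hf hgf hz⟩, ?_⟩
  rintro _ rfl
  refine ⟨isConvexUnivalent_div_one_sub,
    ⟨id, differentiableOn_id, mapsTo_id _, rfl, fun z _ => rfl⟩, fun r hr hr1 => ?_⟩
  have hgeo := (hasSum_geometric_of_lt_one (by linarith : (0 : ℝ) ≤ r) hr1).mul_left r
  simp only [taylorCoeff_div_one_sub (Nat.succ_ne_zero _), norm_one, one_mul, pow_succ']
  refine ⟨hgeo.summable, ?_⟩
  have hfr : ‖(r : ℂ) / (1 - r)‖ = r * (1 - r)⁻¹ := by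
    rw [← ofReal_one, ← ofReal_sub, ← ofReal_div, norm_real,
      norm_of_nonneg (div_nonneg (by linarith) (by linarith)), div_eq_mul_inv]
  rw [hgeo.tsum_eq, hfr, zero_div, norm_zero, zero_add]
  refine boundaryDist_div_one_sub_le.trans_lt ?_
  have : 1 / 4 < r * (1 - r)⁻¹ := by
    rw [← div_eq_mul_inv, lt_div_iff₀ (by linarith)]
    linarith
  linarith
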